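/- Let $\mathcal A$ be a commutative $\mathbb C$-algebra and let $\mathcal C=\mathcal A[[t_1,t_2,\dots]]$ be the ring of formal power series in infinitely many variables $t_n$ ($n=1,2,\dots$). Consider $\mathbb Z\times\mathbb Z$ matrices with entries in $\mathcal C$; let $\Lambda=(\delta_{\mu+1,\nu})_{\mu,\nu\in\mathbb Z}$ be the shift matrix, and for a sequence $a=(a(s))_{s\in\mathbb Z}$ in $\mathcal C$ write $a(s)\Lambda^k$ for the product of the diagonal matrix $\mathrm{diag}_s[a(s)]$ with $\Lambda^k$ ($k\in\mathbb Z$). Derivatives $\partial/\partial t_n$ of matrices are taken entrywise, and $[P,Q]=PQ-QP$. For each $n=1,2,\dots$ let $$B_n=\sum_{j=0}^{n} b^{(n)}_j(s)\,\Lambda^j,\qquad b^{(n)}_j(s)\in\mathcal C,\quad b^{(n)}_n(s)=1 \text{ for all } s\in\mathbb Z,$$ and suppose that the Zakharov--Shabat equations $$\frac{\partial B_m}{\partial t_n}-\frac{\partial B_n}{\partial t_m}+[B_m,B_n]=0$$ hold for all $m,n=1,2,\dots$. Then there exists a matrix $$L=\sum_{j=0}^{\infty}u_{1-j}(s)\,\Lambda^{1-j},\qquad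 u_{1-j}(s)\in\mathcal C,\quad u_1(s)=1 \text{ for all } s\in\mathbb Z,$$ which satisfies the Lax equations $$\frac{\partial L}{\partial t_n}-[B_n,L]=0\qquad\text{for all } n=1,2,\dots.$$ (All matrix products involved have entries given by finite sums.) -/

import Mathlib

/-- The ring `A[[t₁, t₂, …]]` of formal power series in the times `tₙ`, `n = 1, 2, …`. -/
abbrev TimeSeries (A : Type*) : Type _ := MvPowerSeries ℕ+ A

/-- `ℤ × ℤ` matrices with entries in `A[[t₁, t₂, …]]`. -/
abbrev ZMatrix (A : Type*) : Type _ := Matrix ℤ ℤ (TimeSeries A)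

namespace ZMatrix

variable {A : Type*} [CommRing A]

/-- `diag_s[a(s)] Λ ^ k`, where `Λ = (δ_{μ+1,ν})` is the shift matrix: the entry in row `s` and
column `s + k` is `a(s)`, and all other entries vanish. -/
def diagShift (a : ℤ → TimeSeries A) (k : ℤ) : ZMatrix A :=
  Matrix.of fun μ ν => if μ + k = ν then a μ else 0

/-- The infinite sum `∑_{k ≤ N} diag_s[a_k(s)] Λ ^ k`. Each entry of the sum gets a contribution
from at most one `k`, namely `k = ν - μ`. -/
def lowerSeries (N : ℤ) (a : ℤ → ℤ → TimeSeries A) : ZMatrix A :=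
  Matrix.of fun μ ν => if ν - μ ≤ N then a (ν - μ) μ else 0

/-- The product of `ℤ × ℤ` matrices. For matrices `∑_{k ≤ N} a_k(s) Λ ^ k` the sum over the inner
index has finitely many nonzero terms, see `finite_support_mul`. -/
noncomputable def mul (P Q : ZMatrix A) : ZMatrix A :=
  Matrix.of fun μ ν => ∑ᶠ κ : ℤ, P μ κ * Q κ ν

/-- The commutator `[P, Q] = PQ - QP`. -/
noncomputable def comm (P Q : ZMatrix A) : ZMatrix A := mul P Q - mul Q P

/-- The entrywise derivative `∂P/∂tₙ`. -/
noncomputable def timeDeriv (n : ℕ+) (P : ZMatrix A) : ZMatrix A :=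
  P.map (MvPowerSeries.pderiv A n)

theorem finite_support_mul {P Q : ZMatrix A} {M N : ℤ}
    (hP : ∀ μ ν, M < ν - μ → P μ ν = 0) (hQ : ∀ μ ν, N < ν - μ → Q μ ν = 0) (μ ν : ℤ) :
    (Function.support fun κ : ℤ => P μ κ * Q κ ν).Finite := by
  refine (Set.finite_Icc (ν - N) (μ + M)).subset fun κ hκ => ?_
  rw [Function.mem_support] at hκ
  constructor
  · by_contra h
    exact hκ (by rw [hQ κ ν (by omega), mul_zero])
  · by_contra h
    exact hκ (by rw [hP μ κ (by omega), zero_mul])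

end ZMatrix

/-!
A solution of the Lax equations is an operator annihilated by all the derivations
`∇ₙX = ∂ₙX - [Bₙ, X]`. The Zakharov–Shabat equations say `∇ₙBₘ = ∂ₘBₙ`, which has order less than
`n` whatever `m` is, because `Bₙ` is monic. By the Leibniz rule the quotients `Bₘ₊ₖ Bₘ⁻¹`, monic of
order `k`, satisfy `∇ₙ(Bₘ₊ₖ Bₘ⁻¹) = O(Λ ^ (n - m + const))` for all `n`, so they solve the Lax
equations to arbitrarily low order as `m → ∞`.

These quotients need not converge, but their failure to do so is under control: if `X` has order `k`
and `∇ₙX` has order less than `n + k` for all large `n`, then comparing the coefficients of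
`Λ ^ (n + k)` shows that the leading coefficient of `X` is independent of `s`. The difference of two
approximate solutions is therefore, to low order, a combination `∑ dⱼ Vⱼ` of approximate solutions
with scalar coefficients, and `∂ₙdⱼ = 0` for `n` up to a bound `i`. Replacing `dⱼ` by its part
`gⱼ` free of `tᵢ₊₁, tᵢ₊₂, …`, a true constant, and adding `∑ gⱼ Vⱼ` to the better of the two
approximate solutions gives a sequence that converges in the order and in the number of variables
simultaneously.
-/

section Filtration

variable {R : Type*} [CommRing R]

/-- A sequence of ideals for which every sequence `f` with `f (i + 1) ≡ f i` modulo `J i` has a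
limit. -/
def IsCompleteFiltration (J : ℕ → Ideal R) : Prop :=
  ∀ f : ℕ → R, (∀ i, f (i + 1) - f i ∈ J i) → ∃ r, ∀ i, r - f i ∈ J i

theorem isCompleteFiltration_bot : IsCompleteFiltration fun _ => (⊥ : Ideal R) := fun f hf =>
  ⟨f 0, fun i => by
    simp only [Ideal.mem_bot, sub_eq_zero] at hf ⊢
    induction i with
    | zero => rfl
    | succ i ih => rw [ih, hf]⟩

theorem IsCompleteFiltration.exists_limit_of_ge {J : ℕ → Ideal R} (hJ : IsCompleteFiltration J)
    (c : ℕ) (f : ℕ → R) (hf : ∀ i ≥ c, f (i + 1) - f i ∈ J i) :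
    ∃ r, ∀ i ≥ c, r - f i ∈ J i := by
  obtain ⟨r, hr⟩ := hJ (fun i => f (max i c)) fun i => by
    obtain h | h := le_or_gt c i
    · simpa only [max_eq_left h, max_eq_left (h.trans i.le_succ)] using hf i h
    · simp only [max_eq_right h.le, max_eq_right (Nat.succ_le_of_lt h), sub_self, zero_mem]
  exact ⟨r, fun i hi => by simpa only [max_eq_left hi] using hr i⟩

/-- Ideals `J 0, J 1, …` of elements that are small for the derivations `∂ₙ = D n`, defining a
complete separated topology: `∂ₙ` preserves `J i` for `n ≤ i`, and the elements annihilated by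
`∂₁, …, ∂ᵢ` are constants up to elements of `J i`. For power series in `t₁, t₂, …`, `J i` consists
of the series that vanish at `tᵢ₊₁ = tᵢ₊₂ = ⋯ = 0`. -/
structure IsTimeFiltration {S : Type*} [CommSemiring S] [Algebra S R]
    (D : ℕ+ → Derivation S R R) (J : ℕ → Ideal R) : Prop where
  complete : IsCompleteFiltration J
  separated : ∀ r, (∀ᶠ i in Filter.atTop, r ∈ J i) → r = 0
  deriv_mem : ∀ (n : ℕ+) (i : ℕ), n ≤ i → ∀ r ∈ J i, D n r ∈ J i
  exists_sub_mem : ∀ (i : ℕ) (r : R), (∀ n : ℕ+, n ≤ i → D n r = 0) →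
    ∃ g, (∀ n, D n g = 0) ∧ r - g ∈ J i

end Filtration

/-- Difference operators `∑_{k ≤ N} diag_s[a_k(s)] Λ ^ k` over `R`, encoded as `ℤ × ℤ` matrices
whose entries vanish sufficiently far above the diagonal. -/
def DiffOp (R : Type*) [CommRing R] : Submodule R (Matrix ℤ ℤ R) where
  carrier := {P | ∃ N : ℤ, ∀ μ ν, N < ν - μ → P μ ν = 0}
  zero_mem' := ⟨0, fun _ _ _ => rfl⟩
  add_mem' := by
    rintro P Q ⟨M, hM⟩ ⟨N, hN⟩
    refine ⟨max M N, fun μ ν h => ?_⟩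
    rw [Matrix.add_apply, hM μ ν (by omega), hN μ ν (by omega), add_zero]
  smul_mem' := by
    rintro c P ⟨N, hN⟩
    exact ⟨N, fun μ ν h => by rw [Matrix.smul_apply, hN μ ν h, smul_zero]⟩

namespace DiffOp

section Ring

variable {R : Type*} [CommRing R]

@[ext]
theorem ext {P Q : DiffOp R} (h : ∀ μ ν, P.1 μ ν = Q.1 μ ν) : P = Q :=
  Subtype.ext (Matrix.ext h)

@[simp] theorem add_apply (P Q : DiffOp R) (μ ν : ℤ) : (P + Q).1 μ ν = P.1 μ ν + Q.1 μ ν := rfl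

@[simp] theorem sub_apply (P Q : DiffOp R) (μ ν : ℤ) : (P - Q).1 μ ν = P.1 μ ν - Q.1 μ ν := rfl

@[simp] theorem smul_apply (c : R) (P : DiffOp R) (μ ν : ℤ) : (c • P).1 μ ν = c * P.1 μ ν := rfl

/-- The coefficient `s ↦ a_k(s)` of `Λ ^ k` in a difference operator. -/
def coeff (k : ℤ) : DiffOp R →ₗ[R] (ℤ → R) where
  toFun P s := P.1 s (s + k)
  map_add' _ _ := rfl
  map_smul' _ _ := rfl

theorem coeff_apply (k : ℤ) (P : DiffOp R) (s : ℤ) : coeff k P s = P.1 s (s + k) := rfl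

/-- Difference operators whose coefficients of `Λ ^ l` lie in the ideal `J` for all `l > k`. For
`J = ⊥` these are the operators of order at most `k`. -/
def ordLE (J : Ideal R) (k : ℤ) : Submodule R (DiffOp R) where
  carrier := {P | ∀ μ ν, k < ν - μ → P.1 μ ν ∈ J}
  zero_mem' _ _ _ := J.zero_mem
  add_mem' hP hQ μ ν h := J.add_mem (hP μ ν h) (hQ μ ν h)
  smul_mem' c _ hP μ ν h := J.mul_mem_left c (hP μ ν h)

theorem ordLE_mono {I J : Ideal R} {k l : ℤ} (hIJ : I ≤ J) (hkl : k ≤ l) :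
    ordLE I k ≤ ordLE J l :=
  fun _ hP μ ν h => hIJ (hP μ ν (by omega))

theorem ordLE_le_of_le (J : Ideal R) {k l : ℤ} (hkl : k ≤ l) : ordLE J k ≤ ordLE J l :=
  ordLE_mono le_rfl hkl

theorem exists_mem_ordLE (P : DiffOp R) : ∃ k, P ∈ ordLE ⊥ k := P.2

theorem mem_ordLE_of_coeff_mem {J : Ideal R} {k l : ℤ} {P : DiffOp R} (hP : P ∈ ordLE J k)
    (hk : ∀ s, coeff k P s ∈ J) (hl : k ≤ l + 1) : P ∈ ordLE J l := by
  intro μ ν h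
  obtain h' | h' := lt_or_ge k (ν - μ)
  · exact hP μ ν h'
  · simpa only [coeff_apply, show μ + k = ν by omega] using hk μ

theorem coeff_eq_zero_of_mem_ordLE {k l : ℤ} {P : DiffOp R} (hP : P ∈ ordLE ⊥ k) (h : k < l)
    (s : ℤ) : coeff l P s = 0 :=
  hP s (s + l) (by omega)

theorem smul_mem_ordLE_of_mem {J : Ideal R} {c : R} (hc : c ∈ J) (P : DiffOp R) (k : ℤ) :
    c • P ∈ ordLE J k :=
  fun _ _ _ => J.mul_mem_right _ hc

theorem eq_zero_of_forall_mem_ordLE {J : ℕ → Ideal R} {P : DiffOp R} (c : ℤ)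
    (hJ : ∀ r, (∀ᶠ i in Filter.atTop, r ∈ J i) → r = 0)
    (h : ∀ᶠ i : ℕ in Filter.atTop, P ∈ ordLE (J i) (c - i)) : P = 0 := by
  ext μ ν
  refine hJ _ ?_
  filter_upwards [h, Filter.eventually_gt_atTop (c - (ν - μ)).toNat] with i hi hic
  exact hi μ ν (by omega)

noncomputable instance : Mul (DiffOp R) where
  mul P Q := ⟨Matrix.of fun μ ν => ∑ᶠ κ : ℤ, P.1 μ κ * Q.1 κ ν, by
    obtain ⟨M, hM⟩ := P.2
    obtain ⟨N, hN⟩ := Q.2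
    refine ⟨M + N, fun μ ν h => finsum_eq_zero_of_forall_eq_zero fun κ => ?_⟩
    obtain hκ | hκ := lt_or_ge M (κ - μ)
    · rw [hM μ κ hκ, zero_mul]
    · rw [hN κ ν (by omega), mul_zero]⟩

theorem mul_apply_eq_sum {P Q : DiffOp R} {M N : ℤ} (hP : P ∈ ordLE ⊥ M) (hQ : Q ∈ ordLE ⊥ N)
    {μ ν a b : ℤ} (ha : a ≤ ν - N) (hb : μ + M ≤ b) :
    (P * Q).1 μ ν = ∑ κ ∈ Finset.Icc a b, P.1 μ κ * Q.1 κ ν := by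
  refine finsum_eq_sum_of_support_subset _ fun κ hκ => ?_
  rw [Function.mem_support] at hκ
  rw [Finset.coe_Icc]
  constructor
  · by_contra h
    exact hκ (by rw [hQ κ ν (by omega), mul_zero])
  · by_contra h
    exact hκ (by rw [hP μ κ (by omega), zero_mul])

theorem mul_mem_ordLE {J : Ideal R} {P Q : DiffOp R} {M N : ℤ} (hP : P ∈ ordLE J M)
    (hQ : Q ∈ ordLE J N) : P * Q ∈ ordLE J (M + N) := by
  refine fun μ ν h => finsum_induction (· ∈ J) J.zero_mem (fun _ _ => J.add_mem) fun κ => ?_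
  obtain hκ | hκ := lt_or_ge M (κ - μ)
  · exact J.mul_mem_right _ (hP μ κ hκ)
  · exact J.mul_mem_left _ (hQ κ ν (by omega))

protected theorem mul_assoc (P Q S : DiffOp R) : P * Q * S = P * (Q * S) := by
  obtain ⟨l, hP⟩ := exists_mem_ordLE P
  obtain ⟨m, hQ⟩ := exists_mem_ordLE Q
  obtain ⟨n, hS⟩ := exists_mem_ordLE S
  ext μ ν
  rw [mul_apply_eq_sum (mul_mem_ordLE hP hQ) hS le_rfl le_rfl,
    mul_apply_eq_sum hP (mul_mem_ordLE hQ hS) le_rfl le_rfl]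
  have expand_left : ∀ κ ∈ Finset.Icc (ν - n) (μ + (l + m)), (P * Q).1 μ κ * S.1 κ ν =
      ∑ i ∈ Finset.Icc (ν - (m + n)) (μ + l), P.1 μ i * Q.1 i κ * S.1 κ ν := by
    intro κ hκ
    rw [Finset.mem_Icc] at hκ
    rw [mul_apply_eq_sum hP hQ (a := ν - (m + n)) (by omega) le_rfl, Finset.sum_mul]
  have expand_right : ∀ i ∈ Finset.Icc (ν - (m + n)) (μ + l), P.1 μ i * (Q * S).1 i ν =
      ∑ κ ∈ Finset.Icc (ν - n) (μ + (l + m)), P.1 μ i * Q.1 i κ * S.1 κ ν := by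
    intro i hi
    rw [Finset.mem_Icc] at hi
    rw [mul_apply_eq_sum hQ hS (b := μ + (l + m)) le_rfl (by omega), Finset.mul_sum]
    simp only [mul_assoc]
  rw [Finset.sum_congr rfl expand_left, Finset.sum_congr rfl expand_right, Finset.sum_comm]

protected theorem add_mul (P Q S : DiffOp R) : (P + Q) * S = P * S + Q * S := by
  obtain ⟨l, hP⟩ := exists_mem_ordLE P
  obtain ⟨m, hQ⟩ := exists_mem_ordLE Q
  obtain ⟨n, hS⟩ := exists_mem_ordLE S
  replace hP := ordLE_le_of_le ⊥ (le_max_left l m) hP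
  replace hQ := ordLE_le_of_le ⊥ (le_max_right l m) hQ
  ext μ ν
  rw [add_apply, mul_apply_eq_sum (add_mem hP hQ) hS le_rfl le_rfl,
    mul_apply_eq_sum hP hS le_rfl le_rfl, mul_apply_eq_sum hQ hS le_rfl le_rfl]
  simp only [add_apply, add_mul, Finset.sum_add_distrib]

protected theorem mul_add (P Q S : DiffOp R) : P * (Q + S) = P * Q + P * S := by
  obtain ⟨l, hP⟩ := exists_mem_ordLE P
  obtain ⟨m, hQ⟩ := exists_mem_ordLE Q
  obtain ⟨n, hS⟩ := exists_mem_ordLE S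
  replace hQ := ordLE_le_of_le ⊥ (le_max_left m n) hQ
  replace hS := ordLE_le_of_le ⊥ (le_max_right m n) hS
  ext μ ν
  rw [add_apply, mul_apply_eq_sum hP (add_mem hQ hS) le_rfl le_rfl,
    mul_apply_eq_sum hP hQ le_rfl le_rfl, mul_apply_eq_sum hP hS le_rfl le_rfl]
  simp only [add_apply, mul_add, Finset.sum_add_distrib]

/-- The operator `diag_s[a(s)] Λ ^ k`. -/
def monomial (a : ℤ → R) (k : ℤ) : DiffOp R :=
  ⟨Matrix.of fun μ ν => if μ + k = ν then a μ else 0, k, fun _ _ _ => if_neg (by omega)⟩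

theorem coeff_monomial (a : ℤ → R) (k : ℤ) : coeff k (monomial a k) = a :=
  funext fun _ => if_pos rfl

theorem monomial_mem_ordLE (a : ℤ → R) (k : ℤ) : monomial a k ∈ ordLE ⊥ k :=
  fun _ _ _ => if_neg (by omega)

instance : One (DiffOp R) := ⟨monomial 1 0⟩

protected theorem one_mul (P : DiffOp R) : 1 * P = P := by
  ext μ ν
  refine (finsum_eq_single _ μ fun κ hκ => ?_).trans ?_
  · rw [show (1 : DiffOp R).1 μ κ = 0 from if_neg (by omega), zero_mul]
  · rw [show (1 : DiffOp R).1 μ μ = 1 from if_pos (by omega), one_mul]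

protected theorem mul_one (P : DiffOp R) : P * 1 = P := by
  ext μ ν
  refine (finsum_eq_single _ ν fun κ hκ => ?_).trans ?_
  · rw [show (1 : DiffOp R).1 κ ν = 0 from if_neg (by omega), mul_zero]
  · rw [show (1 : DiffOp R).1 ν ν = 1 from if_pos (by omega), mul_one]

noncomputable instance : Ring (DiffOp R) :=
  { (inferInstance : AddCommGroup (DiffOp R)), (inferInstance : Mul (DiffOp R)),
    (inferInstance : One (DiffOp R)) with
    mul_assoc := DiffOp.mul_assoc
    left_distrib := DiffOp.mul_add
    right_distrib := DiffOp.add_mul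
    zero_mul := fun P => by simpa using DiffOp.add_mul 0 0 P
    mul_zero := fun P => by simpa using DiffOp.mul_add P 0 0
    one_mul := DiffOp.one_mul
    mul_one := DiffOp.mul_one }

protected theorem smul_mul (c : R) (P Q : DiffOp R) : c • P * Q = c • (P * Q) := by
  obtain ⟨m, hP⟩ := exists_mem_ordLE P
  obtain ⟨n, hQ⟩ := exists_mem_ordLE Q
  ext μ ν
  rw [smul_apply, mul_apply_eq_sum (Submodule.smul_mem _ c hP) hQ le_rfl le_rfl,
    mul_apply_eq_sum hP hQ le_rfl le_rfl]
  simp only [smul_apply, Finset.mul_sum, mul_assoc]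

protected theorem mul_smul (c : R) (P Q : DiffOp R) : P * c • Q = c • (P * Q) := by
  obtain ⟨m, hP⟩ := exists_mem_ordLE P
  obtain ⟨n, hQ⟩ := exists_mem_ordLE Q
  ext μ ν
  rw [smul_apply, mul_apply_eq_sum hP (Submodule.smul_mem _ c hQ) le_rfl le_rfl,
    mul_apply_eq_sum hP hQ le_rfl le_rfl]
  simp only [smul_apply, Finset.mul_sum, mul_left_comm]

noncomputable instance : Algebra R (DiffOp R) := Algebra.ofModule DiffOp.smul_mul DiffOp.mul_smul

theorem coeff_mul {P Q : DiffOp R} {M N : ℤ} (hP : P ∈ ordLE ⊥ M) (hQ : Q ∈ ordLE ⊥ N) (s : ℤ) :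
    coeff (M + N) (P * Q) s = coeff M P s * coeff N Q (s + M) := by
  simp only [coeff_apply]
  rw [mul_apply_eq_sum hP hQ le_rfl le_rfl, show s + (M + N) - N = s + M by ring, Finset.Icc_self,
    Finset.sum_singleton, add_assoc]

end Ring

section Completeness

variable {R : Type*} [CommRing R]

theorem exists_limit {J : ℕ → Ideal R} (hJ : IsCompleteFiltration J) {k c : ℤ} {P : ℕ → DiffOp R}
    (hP : ∀ i, P i ∈ ordLE ⊥ k) (hPJ : ∀ i : ℕ, P (i + 1) - P i ∈ ordLE (J i) (c - i)) :
    ∃ L ∈ ordLE ⊥ k, ∀ i : ℕ, L - P i ∈ ordLE (J i) (c - i) := by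
  have entry_limit (μ ν : ℤ) : ∃ r, (k < ν - μ → r = 0) ∧
      ∀ i : ℕ, c - i < ν - μ → r - (P i).1 μ ν ∈ J i := by
    by_cases h : k < ν - μ
    · refine ⟨0, fun _ => rfl, fun i _ => ?_⟩
      rw [hP i μ ν h, sub_self]
      exact zero_mem _
    · obtain ⟨r, hr⟩ := hJ.exists_limit_of_ge (c - (ν - μ) + 1).toNat (fun i => (P i).1 μ ν)
        fun i hi => hPJ i μ ν (by omega)
      exact ⟨r, fun h' => absurd h' h, fun i hi => hr i (by omega)⟩
  choose L hLk hL using entry_limit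
  exact ⟨⟨Matrix.of L, k, hLk⟩, hLk, fun i μ ν h => hL μ ν i h⟩

theorem exists_limit_of_step {J : ℕ → Ideal R} (hJ : IsCompleteFiltration J) {k c : ℤ}
    {p : ℕ → DiffOp R → Prop} (hp : ∀ i P, p i P → P ∈ ordLE ⊥ k) (zero : ∃ P, p 0 P)
    (step : ∀ i P, p i P → ∃ Q, p (i + 1) Q ∧ Q - P ∈ ordLE (J i) (c - i)) :
    ∃ L ∈ ordLE ⊥ k, ∀ i : ℕ, ∃ P, p i P ∧ L - P ∈ ordLE (J i) (c - i) := by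
  obtain ⟨P₀, hP₀⟩ := zero
  choose! next hnext hsub using step
  let P : ℕ → DiffOp R := fun i => Nat.rec P₀ next i
  have hpP (i : ℕ) : p i (P i) := by
    induction i with
    | zero => exact hP₀
    | succ i ih => exact hnext i _ ih
  obtain ⟨L, hLk, hL⟩ := exists_limit hJ (P := P) (fun i => hp i _ (hpP i))
    fun i => hsub i _ (hpP i)
  exact ⟨L, hLk, fun i => ⟨P i, hpP i, hL i⟩⟩

end Completeness

section Monic

variable {R : Type*} [CommRing R]

/-- Operators with leading term `Λ ^ k`. -/
structure IsMonic (P : DiffOp R) (k : ℤ) : Prop where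
  mem_ordLE : P ∈ ordLE ⊥ k
  coeff_eq_one : coeff k P = 1

theorem IsMonic.sub_monomial_mul_mem {B : DiffOp R} {m : ℤ} (hB : IsMonic B m) {P : DiffOp R}
    {k : ℤ} (hP : P ∈ ordLE ⊥ (k + m)) :
    P - monomial (coeff (k + m) P) k * B ∈ ordLE ⊥ (k + m - 1) := by
  have hT := monomial_mem_ordLE (coeff (k + m) P) k
  refine mem_ordLE_of_coeff_mem (sub_mem hP (mul_mem_ordLE hT hB.mem_ordLE)) (fun s => ?_)
    (by omega)
  simp [coeff_mul hT hB.mem_ordLE, coeff_monomial, hB.coeff_eq_one]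

theorem IsMonic.exists_mul_eq {B : DiffOp R} {m : ℤ} (hB : IsMonic B m) {P : DiffOp R} {k : ℤ}
    (hP : P ∈ ordLE ⊥ (k + m)) : ∃ U ∈ ordLE ⊥ k, U * B = P := by
  obtain ⟨U, hUk, hU⟩ := exists_limit_of_step (k := k) (c := k) isCompleteFiltration_bot
    (p := fun i U => U ∈ ordLE ⊥ k ∧ P - U * B ∈ ordLE ⊥ (k - i + m))
    (fun _ _ h => h.1) ⟨0, zero_mem _, by simpa using hP⟩ (by
      rintro i U ⟨hU, hPU⟩
      set T := monomial (coeff (k - i + m) (P - U * B)) (k - i)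
      have hT : T ∈ ordLE ⊥ (k - i) := monomial_mem_ordLE _ _
      refine ⟨U + T, ⟨add_mem hU (ordLE_le_of_le ⊥ (by omega) hT), ?_⟩, by simpa using hT⟩
      rw [add_mul, ← sub_sub]
      exact ordLE_le_of_le ⊥ (by push_cast; omega) (hB.sub_monomial_mul_mem hPU))
  refine ⟨U, hUk, (sub_eq_zero.mp ?_).symm⟩
  refine eq_zero_of_forall_mem_ordLE (J := fun _ => ⊥) (k + m)
    (fun r hr => hr.exists.elim fun _ h => h) (.of_forall fun i => ?_)
  obtain ⟨V, ⟨-, hPV⟩, hUV⟩ := hU i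
  have hUVB := mul_mem_ordLE hUV hB.mem_ordLE
  rw [sub_mul] at hUVB
  simpa [sub_add_eq_add_sub] using sub_mem hPV hUVB

theorem IsMonic.mem_ordLE_of_mul {B : DiffOp R} {m : ℤ} (hB : IsMonic B m) {X : DiffOp R} {l : ℤ}
    (hXB : X * B ∈ ordLE ⊥ (l + m)) : X ∈ ordLE ⊥ l := by
  obtain ⟨c, hlc, hX⟩ : ∃ c ≥ l, X ∈ ordLE ⊥ c :=
    let ⟨c, hc⟩ := exists_mem_ordLE X
    ⟨max l c, le_max_left l c, ordLE_le_of_le ⊥ (le_max_right l c) hc⟩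
  induction c, hlc using Int.leInduction with
  | base => exact hX
  | succ c hlc ih =>
    refine ih (mem_ordLE_of_coeff_mem hX (fun s => ?_) le_rfl)
    have hs := coeff_eq_zero_of_mem_ordLE hXB (by omega : l + m < c + 1 + m) s
    rwa [coeff_mul hX hB.mem_ordLE, hB.coeff_eq_one, Pi.one_apply, mul_one] at hs

theorem IsMonic.exists_isMonic_mul_eq {B P : DiffOp R} {m k : ℤ} (hB : IsMonic B m)
    (hP : IsMonic P (k + m)) : ∃ U, IsMonic U k ∧ U * B = P := by
  obtain ⟨U, hU, rfl⟩ := hB.exists_mul_eq hP.mem_ordLE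
  refine ⟨U, ⟨hU, funext fun s => ?_⟩, rfl⟩
  have hs := congrFun hP.coeff_eq_one s
  rwa [coeff_mul hU hB.mem_ordLE, hB.coeff_eq_one, Pi.one_apply, mul_one] at hs

theorem IsMonic.add {P Q : DiffOp R} {k : ℤ} (hP : IsMonic P k) (hQ : Q ∈ ordLE ⊥ (k - 1)) :
    IsMonic (P + Q) k where
  mem_ordLE := add_mem hP.mem_ordLE (ordLE_le_of_le ⊥ (by omega) hQ)
  coeff_eq_one := by
    rw [map_add, hP.coeff_eq_one, funext (coeff_eq_zero_of_mem_ordLE hQ (by omega))]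
    exact add_zero _

theorem isMonic_sum_monomial {n : ℕ} {a : ℕ → ℤ → R} (ha : a n = 1) :
    IsMonic (∑ j ∈ Finset.range (n + 1), monomial (a j) j) n := by
  rw [Finset.sum_range_succ, add_comm, ha]
  refine IsMonic.add ⟨monomial_mem_ordLE 1 n, coeff_monomial 1 n⟩ (sum_mem fun j hj => ?_)
  rw [Finset.mem_range] at hj
  exact ordLE_le_of_le ⊥ (by omega) (monomial_mem_ordLE _ _)

theorem IsMonic.sub_smul_mem {V X : DiffOp R} {k : ℤ} {d : R} (hV : IsMonic V k)
    (hX : X ∈ ordLE ⊥ k) (hd : ∀ s, coeff k X s = d) : X - d • V ∈ ordLE ⊥ (k - 1) := by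
  refine mem_ordLE_of_coeff_mem (sub_mem hX (Submodule.smul_mem _ d hV.mem_ordLE)) (fun s => ?_)
    (by omega)
  simp [hd, hV.coeff_eq_one]

end Monic

section LaxDerivative

variable {S R : Type*} [CommSemiring S] [CommRing R] [Algebra S R]

/-- The entrywise application of a derivation to a difference operator. -/
def mapDeriv (d : Derivation S R R) : DiffOp R →+ DiffOp R where
  toFun P := ⟨P.1.map d, P.2.imp fun _ hN μ ν h => by rw [Matrix.map_apply, hN μ ν h, map_zero]⟩
  map_zero' := by ext; exact map_zero d
  map_add' P Q := by ext; exact map_add d _ _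

theorem mapDeriv_apply (d : Derivation S R R) (P : DiffOp R) (μ ν : ℤ) :
    (mapDeriv d P).1 μ ν = d (P.1 μ ν) := rfl

theorem mapDeriv_mem_ordLE {d : Derivation S R R} {J : Ideal R} (hd : ∀ r ∈ J, d r ∈ J)
    {P : DiffOp R} {k : ℤ} (hP : P ∈ ordLE J k) : mapDeriv d P ∈ ordLE J k :=
  fun μ ν h => hd _ (hP μ ν h)

theorem mapDeriv_mem_ordLE_bot (d : Derivation S R R) {P : DiffOp R} {k : ℤ}
    (hP : P ∈ ordLE ⊥ k) : mapDeriv d P ∈ ordLE ⊥ k :=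
  mapDeriv_mem_ordLE (by simp) hP

theorem IsMonic.mapDeriv_mem_ordLE (d : Derivation S R R) {P : DiffOp R} {k : ℤ}
    (hP : IsMonic P k) : mapDeriv d P ∈ ordLE ⊥ (k - 1) := by
  refine mem_ordLE_of_coeff_mem (mapDeriv_mem_ordLE_bot d hP.mem_ordLE) (fun s => ?_) (by omega)
  have hs : P.1 s (s + k) = 1 := congrFun hP.coeff_eq_one s
  simp [coeff_apply, mapDeriv_apply, hs]

theorem mapDeriv_smul (d : Derivation S R R) (c : R) (P : DiffOp R) :
    mapDeriv d (c • P) = d c • P + c • mapDeriv d P := by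
  ext μ ν
  simp [mapDeriv_apply, mul_comm, add_comm]

theorem mapDeriv_mul (d : Derivation S R R) (P Q : DiffOp R) :
    mapDeriv d (P * Q) = mapDeriv d P * Q + P * mapDeriv d Q := by
  obtain ⟨m, hP⟩ := exists_mem_ordLE P
  obtain ⟨n, hQ⟩ := exists_mem_ordLE Q
  ext μ ν
  rw [add_apply, mapDeriv_apply, mul_apply_eq_sum hP hQ le_rfl le_rfl,
    mul_apply_eq_sum (mapDeriv_mem_ordLE_bot d hP) hQ le_rfl le_rfl,
    mul_apply_eq_sum hP (mapDeriv_mem_ordLE_bot d hQ) le_rfl le_rfl, map_sum,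
    ← Finset.sum_add_distrib]
  refine Finset.sum_congr rfl fun κ _ => ?_
  rw [Derivation.leibniz, mapDeriv_apply, mapDeriv_apply, smul_eq_mul, smul_eq_mul, add_comm,
    mul_comm (Q.1 κ ν)]

/-- The derivation `X ↦ ∂X - [B, X]`, whose kernel consists of the solutions of the Lax equation
`∂X = [B, X]`. -/
noncomputable def laxDeriv (d : Derivation S R R) (B : DiffOp R) : DiffOp R →+ DiffOp R :=
  mapDeriv d - (AddMonoidHom.mulLeft B - AddMonoidHom.mulRight B)

theorem laxDeriv_apply (d : Derivation S R R) (B X : DiffOp R) :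
    laxDeriv d B X = mapDeriv d X - (B * X - X * B) := rfl

theorem laxDeriv_smul (d : Derivation S R R) (B : DiffOp R) (c : R) (X : DiffOp R) :
    laxDeriv d B (c • X) = d c • X + c • laxDeriv d B X := by
  simp only [laxDeriv_apply, mapDeriv_smul, mul_smul_comm, smul_mul_assoc, smul_sub]
  abel

theorem laxDeriv_mul (d : Derivation S R R) (B X Y : DiffOp R) :
    laxDeriv d B (X * Y) = laxDeriv d B X * Y + X * laxDeriv d B Y := by
  simp only [laxDeriv_apply, mapDeriv_mul]
  noncomm_ring

theorem laxDeriv_mem_ordLE {d : Derivation S R R} {J : Ideal R} (hd : ∀ r ∈ J, d r ∈ J)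
    {B X : DiffOp R} {n : ℕ} {k : ℤ} (hB : B ∈ ordLE ⊥ n) (hX : X ∈ ordLE J k) :
    laxDeriv d B X ∈ ordLE J (n + k) := by
  replace hB := ordLE_mono (bot_le : ⊥ ≤ J) le_rfl hB
  exact sub_mem (ordLE_le_of_le J (by omega) (mapDeriv_mem_ordLE hd hX))
    (sub_mem (mul_mem_ordLE hB hX) (add_comm k n ▸ mul_mem_ordLE hX hB))

theorem coeff_laxDeriv (d : Derivation S R R) {B X : DiffOp R} {n k : ℤ} (hn : 0 < n)
    (hB : IsMonic B n) (hX : X ∈ ordLE ⊥ k) (s : ℤ) :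
    coeff (n + k) (laxDeriv d B X) s = coeff k X s - coeff k X (s + n) := by
  have hdX := coeff_eq_zero_of_mem_ordLE (mapDeriv_mem_ordLE_bot d hX) (by omega : k < n + k) s
  rw [laxDeriv_apply, map_sub, map_sub, Pi.sub_apply, Pi.sub_apply, hdX,
    coeff_mul hB.mem_ordLE hX, add_comm n k, coeff_mul hX hB.mem_ordLE, hB.coeff_eq_one]
  simp

theorem periodic_coeff_of_laxDeriv_mem {d : Derivation S R R} {B X : DiffOp R} {n k l : ℤ}
    (hn : 0 < n) (hB : IsMonic B n) (hX : X ∈ ordLE ⊥ k) (hl : l < n + k)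
    (h : laxDeriv d B X ∈ ordLE ⊥ l) : Function.Periodic (coeff k X) n := fun s => by
  rw [eq_comm, ← sub_eq_zero, ← coeff_laxDeriv d hn hB hX, coeff_eq_zero_of_mem_ordLE h hl]

end LaxDerivative

section ZakharovShabat

variable {S R : Type*} [CommSemiring S] [CommRing R] [Algebra S R]

/-- Monic operators `B n` of order `n` solving the Zakharov–Shabat equations
`∂ₙBₘ - ∂ₘBₙ + [Bₘ, Bₙ] = 0` for the derivations `∂ₙ = D n`. -/
structure IsZakharovShabat (D : ℕ+ → Derivation S R R) (B : ℕ+ → DiffOp R) : Prop where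
  isMonic (n : ℕ+) : IsMonic (B n) n
  curvature_eq_zero (m n : ℕ+) :
    mapDeriv (D n) (B m) - mapDeriv (D m) (B n) + (B m * B n - B n * B m) = 0

/-- Operators on which all Lax derivatives `∇ₙ` are of order at most `n + e`, up to an error of
order bounded independently of `n`. -/
def almostLax (D : ℕ+ → Derivation S R R) (B : ℕ+ → DiffOp R) (e : ℤ) :
    Submodule R (DiffOp R) where
  carrier := {X | ∃ c : ℤ, ∀ n : ℕ+, laxDeriv (D n) (B n) X ∈ ordLE ⊥ (max c (n + e))}
  zero_mem' := ⟨0, fun n => by rw [map_zero]; exact zero_mem _⟩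
  add_mem' := by
    rintro X Y ⟨c, hX⟩ ⟨c', hY⟩
    refine ⟨max c c', fun n => ?_⟩
    rw [map_add]
    exact add_mem (ordLE_le_of_le ⊥ (by omega) (hX n)) (ordLE_le_of_le ⊥ (by omega) (hY n))
  smul_mem' := by
    rintro r X ⟨c, hX⟩
    obtain ⟨k, hk⟩ := exists_mem_ordLE X
    refine ⟨max c k, fun n => ?_⟩
    rw [laxDeriv_smul]
    exact add_mem (Submodule.smul_mem _ _ (ordLE_le_of_le ⊥ (by omega) hk))
      (Submodule.smul_mem _ _ (ordLE_le_of_le ⊥ (by omega) (hX n)))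

variable {D : ℕ+ → Derivation S R R} {B : ℕ+ → DiffOp R}

theorem mem_almostLax_of_forall {X : DiffOp R} {e : ℤ}
    (hX : ∀ n : ℕ+, laxDeriv (D n) (B n) X ∈ ordLE ⊥ (n + e)) : X ∈ almostLax D B e :=
  ⟨e, fun n => ordLE_le_of_le ⊥ (le_max_right _ _) (hX n)⟩

namespace IsZakharovShabat

theorem laxDeriv_mem_ordLE (h : IsZakharovShabat D B) (m n : ℕ+) :
    laxDeriv (D n) (B n) (B m) ∈ ordLE ⊥ (n - 1 : ℤ) := by
  have hcurv : laxDeriv (D n) (B n) (B m) = mapDeriv (D m) (B n) := by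
    rw [laxDeriv_apply, ← sub_eq_zero, ← h.curvature_eq_zero m n]
    abel
  exact hcurv ▸ (h.isMonic n).mapDeriv_mem_ordLE (D m)

theorem exists_isMonic_laxDeriv_mem (h : IsZakharovShabat D B) (k N : ℤ) :
    ∃ U, IsMonic U k ∧ ∀ n : ℕ+, laxDeriv (D n) (B n) U ∈ ordLE ⊥ (n + N) := by
  -- Take `U = Bₘ₊ₖ Bₘ⁻¹` with `m` large.
  obtain ⟨m, hm, hmk, hmN⟩ : ∃ m : ℤ, 0 < m ∧ 0 < k + m ∧ max 0 k - 1 ≤ N + m :=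
    ⟨max 1 (max (1 - k) (max 0 k - N)), by omega, by omega, by omega⟩
  lift m to ℕ+ using hm
  obtain ⟨l, hl⟩ : ∃ l : ℕ+, (l : ℤ) = k + m := CanLift.prf (k + m) hmk
  obtain ⟨U, hU, hUB⟩ := (h.isMonic m).exists_isMonic_mul_eq (hl ▸ h.isMonic l)
  refine ⟨U, hU, fun n => (h.isMonic m).mem_ordLE_of_mul ?_⟩
  have hleibniz := laxDeriv_mul (D n) (B n) U (B m)
  rw [hUB, ← sub_eq_iff_eq_add] at hleibniz
  rw [← hleibniz]
  exact sub_mem (ordLE_le_of_le ⊥ (by omega) (h.laxDeriv_mem_ordLE l n))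
    (ordLE_le_of_le ⊥ (by omega) (mul_mem_ordLE hU.mem_ordLE (h.laxDeriv_mem_ordLE m n)))

theorem coeff_eq_coeff_zero (h : IsZakharovShabat D B) {X : DiffOp R} {e k : ℤ} (hek : e < k)
    (hX : X ∈ ordLE ⊥ k) (hXe : X ∈ almostLax D B e) (s : ℤ) : coeff k X s = coeff k X 0 := by
  obtain ⟨c, hc⟩ := hXe
  have periodic (n : ℕ+) (hn : c < n + k) : Function.Periodic (coeff k X) n :=
    periodic_coeff_of_laxDeriv_mem (mod_cast n.pos) (h.isMonic n) hX (by omega) (hc n)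
  obtain ⟨n, hn⟩ : ∃ n : ℕ+, c < n + k := ⟨(c - k).toNat.succPNat, by
    rw [Nat.succPNat_coe]; omega⟩
  have periodic_one : Function.Periodic (coeff k X) 1 := by
    simpa using (periodic (n + 1) (by push_cast; omega)).sub_period (periodic n hn)
  simpa using periodic_one.int_mul_eq s

theorem exists_sub_smul_mem_ordLE (h : IsZakharovShabat D B) {X V : DiffOp R} {e k : ℤ}
    (hek : e ≤ k) (hX : X ∈ ordLE ⊥ (k + 1)) (hXe : X ∈ almostLax D B e) (hV : IsMonic V (k + 1))
    (hVe : V ∈ almostLax D B e) :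
    ∃ d : R, X - d • V ∈ ordLE ⊥ k ∧ X - d • V ∈ almostLax D B e := by
  refine ⟨coeff (k + 1) X 0, ?_, sub_mem hXe (Submodule.smul_mem _ _ hVe)⟩
  simpa using hV.sub_smul_mem hX (h.coeff_eq_coeff_zero (by omega) hX hXe)

theorem laxDeriv_mem_ordLE_max (h : IsZakharovShabat D B) {X : DiffOp R} {e k : ℤ} (hek : e ≤ k)
    (hX : X ∈ ordLE ⊥ k) (hXe : X ∈ almostLax D B e) (n : ℕ+) :
    laxDeriv (D n) (B n) X ∈ ordLE ⊥ (max k (n + e)) := by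
  induction k, hek using Int.leInduction generalizing X with
  | base =>
    exact ordLE_le_of_le ⊥ (by omega)
      (DiffOp.laxDeriv_mem_ordLE (by simp) (h.isMonic n).mem_ordLE hX)
  | succ k hek ih =>
    obtain ⟨V, hV, hVe⟩ := h.exists_isMonic_laxDeriv_mem (k + 1) e
    obtain ⟨d, hXV, hXVe⟩ := h.exists_sub_smul_mem_ordLE hek hX hXe hV (mem_almostLax_of_forall hVe)
    rw [← sub_add_cancel X (d • V), map_add, laxDeriv_smul]
    exact add_mem (ordLE_le_of_le ⊥ (by omega) (ih hXV hXVe)) (add_mem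
      (ordLE_le_of_le ⊥ (by omega) (Submodule.smul_mem _ _ hV.mem_ordLE))
      (ordLE_le_of_le ⊥ (by omega) (Submodule.smul_mem _ _ (hVe n))))

theorem exists_laxDeriv_mem_sub_mem_ordLE (h : IsZakharovShabat D B) {J : Ideal R} {a : ℕ}
    (hJ : ∀ r, (∀ n : ℕ+, n ≤ a → D n r = 0) → ∃ g, (∀ n, D n g = 0) ∧ r - g ∈ J)
    {e e' l k : ℤ} (he : e' ≤ e) (hl : a + e ≤ l) (hlk : l ≤ k) {X : DiffOp R}
    (hX : X ∈ ordLE ⊥ k) (hXe : X ∈ almostLax D B e)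
    (hXl : ∀ n : ℕ+, n ≤ a → laxDeriv (D n) (B n) X ∈ ordLE ⊥ l) :
    ∃ Z ∈ ordLE ⊥ k, (∀ n : ℕ+, laxDeriv (D n) (B n) Z ∈ ordLE ⊥ (n + e')) ∧
      X - Z ∈ ordLE J l := by
  induction k, hlk using Int.leInduction generalizing X with
  | base =>
    refine ⟨0, zero_mem _, fun n => by rw [map_zero]; exact zero_mem _, ?_⟩
    simpa using ordLE_mono bot_le le_rfl hX
  | succ k hlk ih =>
    obtain ⟨V, hV, hVe⟩ := h.exists_isMonic_laxDeriv_mem (k + 1) e'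
    obtain ⟨d, hX', hX'e⟩ := h.exists_sub_smul_mem_ordLE (by omega) hX hXe hV
      (mem_almostLax_of_forall fun n => ordLE_le_of_le ⊥ (by omega) (hVe n))
    have laxDeriv_sub (n : ℕ+) : laxDeriv (D n) (B n) (X - d • V) =
        laxDeriv (D n) (B n) X - d • laxDeriv (D n) (B n) V - D n d • V := by
      rw [map_sub, laxDeriv_smul]
      abel
    have laxDeriv_sub_mem (n : ℕ+) (hn : n ≤ a) : laxDeriv (D n) (B n) X -
        d • laxDeriv (D n) (B n) V ∈ ordLE ⊥ l :=
      sub_mem (hXl n hn) (Submodule.smul_mem _ d (ordLE_le_of_le ⊥ (by omega) (hVe n)))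
    have deriv_d (n : ℕ+) (hn : n ≤ a) : D n d = 0 := by
      have hdV : D n d • V ∈ ordLE ⊥ k := by
        rw [← sub_sub_self (laxDeriv (D n) (B n) X - _) (D n d • V), ← laxDeriv_sub]
        exact sub_mem (ordLE_le_of_le ⊥ hlk (laxDeriv_sub_mem n hn)) (ordLE_le_of_le ⊥ (by omega)
          (h.laxDeriv_mem_ordLE_max (by omega) hX' hX'e n))
      simpa [hV.coeff_eq_one] using coeff_eq_zero_of_mem_ordLE hdV (lt_add_one k) 0
    obtain ⟨g, hg, hdg⟩ := hJ d deriv_d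
    obtain ⟨Z, hZ, hZe, hXZ⟩ := ih hX' hX'e fun n hn => by
      simpa [laxDeriv_sub, deriv_d n hn] using laxDeriv_sub_mem n hn
    refine ⟨Z + g • V, add_mem (ordLE_le_of_le ⊥ (by omega) hZ)
      (Submodule.smul_mem _ g hV.mem_ordLE), fun n => ?_, ?_⟩
    · rw [map_add, laxDeriv_smul, hg, zero_smul, zero_add]
      exact add_mem (hZe n) (Submodule.smul_mem _ g (hVe n))
    · convert add_mem hXZ (smul_mem_ordLE_of_mem hdg V l) using 1
      rw [sub_smul]
      abel

theorem exists_next_approximation (h : IsZakharovShabat D B) {J : ℕ → Ideal R}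
    (hJ : IsTimeFiltration D J) {k : ℤ} {i : ℕ} {U : DiffOp R} (hU : IsMonic U k)
    (hUe : ∀ n : ℕ+, laxDeriv (D n) (B n) U ∈ ordLE ⊥ (n + (k - 1 - 2 * i))) :
    ∃ U', IsMonic U' k ∧
      (∀ n : ℕ+, laxDeriv (D n) (B n) U' ∈ ordLE ⊥ (n + (k - 1 - 2 * (i + 1 : ℕ)))) ∧
      U' - U ∈ ordLE (J i) (k - 1 - i) := by
  obtain ⟨V, hV, hVe⟩ := h.exists_isMonic_laxDeriv_mem k (k - 1 - 2 * (i + 1 : ℕ))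
  have hUV : U - V ∈ ordLE ⊥ (k - 1) :=
    mem_ordLE_of_coeff_mem (sub_mem hU.mem_ordLE hV.mem_ordLE)
      (fun s => by simp [hU.coeff_eq_one, hV.coeff_eq_one]) (by omega)
  have hUVe (n : ℕ+) : laxDeriv (D n) (B n) (U - V) ∈ ordLE ⊥ (n + (k - 1 - 2 * i)) := by
    rw [map_sub]
    exact sub_mem (hUe n) (ordLE_le_of_le ⊥ (by omega) (hVe n))
  obtain ⟨Z, hZ, hZe, hUVZ⟩ := h.exists_laxDeriv_mem_sub_mem_ordLE (a := i) (l := k - 1 - i)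
    (e' := k - 1 - 2 * (i + 1 : ℕ)) (hJ.exists_sub_mem i) (by omega) (by omega) (by omega) hUV
    (mem_almostLax_of_forall hUVe) fun n hn => ordLE_le_of_le ⊥ (by omega) (hUVe n)
  refine ⟨V + Z, hV.add hZ, fun n => ?_, ?_⟩
  · rw [map_add]
    exact add_mem (hVe n) (hZe n)
  · rw [← neg_mem_iff]
    simpa [sub_sub] using hUVZ

theorem exists_isMonic_laxDeriv_eq_zero (h : IsZakharovShabat D B) {J : ℕ → Ideal R}
    (hJ : IsTimeFiltration D J) (k : ℤ) :
    ∃ L, IsMonic L k ∧ ∀ n, laxDeriv (D n) (B n) L = 0 := by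
  obtain ⟨L, hLk, hL⟩ := exists_limit_of_step (k := k) (c := k - 1) hJ.complete
    (p := fun i U => IsMonic U k ∧
      ∀ n : ℕ+, laxDeriv (D n) (B n) U ∈ ordLE ⊥ (n + (k - 1 - 2 * i)))
    (fun _ _ hU => hU.1.mem_ordLE) (h.exists_isMonic_laxDeriv_mem k _) fun i U hU =>
      let ⟨U', hU', hU'e, hUU'⟩ := h.exists_next_approximation hJ hU.1 hU.2
      ⟨U', ⟨hU', hU'e⟩, hUU'⟩
  refine ⟨L, ⟨hLk, funext fun s => ?_⟩, fun n => ?_⟩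
  · refine sub_eq_zero.mp (hJ.separated _ (.of_forall fun i => ?_))
    obtain ⟨U, ⟨hU, -⟩, hLU⟩ := hL i
    rw [← congrFun hU.coeff_eq_one s]
    exact hLU s (s + k) (by omega)
  · refine eq_zero_of_forall_mem_ordLE (n + (k - 1)) hJ.separated ?_
    filter_upwards [Filter.eventually_ge_atTop (n : ℕ)] with i hi
    obtain ⟨U, ⟨-, hUe⟩, hLU⟩ := hL i
    rw [← sub_add_cancel L U, map_add]
    have hLU' := DiffOp.laxDeriv_mem_ordLE (hJ.deriv_mem n i hi) (h.isMonic n).mem_ordLE hLU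
    exact add_mem (by rwa [add_sub_assoc])
      (ordLE_mono bot_le (by omega) (hUe n))

end IsZakharovShabat
end ZakharovShabat
end DiffOp

namespace TimeSeries

section Vanishing

variable {σ A : Type*} [CommRing A]

variable (A) in
/-- The power series that vanish when all variables outside `s` are set to `0`. -/
def vanishingIdeal (s : Set σ) : Ideal (MvPowerSeries σ A) where
  carrier := {f | ∀ d : σ →₀ ℕ, ↑d.support ⊆ s → MvPowerSeries.coeff d f = 0}
  zero_mem' d _ := map_zero _
  add_mem' hf hg d hd := by rw [map_add, hf d hd, hg d hd, add_zero]
  smul_mem' f g hg d hd := by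
    classical
    rw [smul_eq_mul, MvPowerSeries.coeff_mul]
    refine Finset.sum_eq_zero fun p hp => ?_
    have hle : p.2 ≤ d := Finset.HasAntidiagonal.mem_antidiagonal.mp hp ▸ le_add_self
    rw [hg p.2 ((Finset.coe_subset.mpr (Finsupp.support_mono hle)).trans hd), mul_zero]

theorem pderiv_mem_vanishingIdeal {s : Set σ} {i : σ} (hi : i ∈ s) {f : MvPowerSeries σ A}
    (hf : f ∈ vanishingIdeal A s) : MvPowerSeries.pderiv A i f ∈ vanishingIdeal A s := by
  classical
  intro d hd
  have hsupp : ↑(d + Finsupp.single i 1).support ⊆ s := by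
    refine (Finset.coe_subset.mpr Finsupp.support_add).trans ?_
    rw [Finset.coe_union]
    refine Set.union_subset hd ((Finset.coe_subset.mpr Finsupp.support_single_subset).trans ?_)
    simpa using hi
  rw [MvPowerSeries.coeff_pderiv, hf _ hsupp, zero_mul]

open Classical in
theorem exists_sub_mem_vanishingIdeal (s : Set σ) (f : MvPowerSeries σ A)
    (hf : ∀ i ∈ s, MvPowerSeries.pderiv A i f = 0) :
    ∃ g, (∀ i, MvPowerSeries.pderiv A i g = 0) ∧ f - g ∈ vanishingIdeal A s := by
  let g : MvPowerSeries σ A := fun d => if ↑d.support ⊆ s then MvPowerSeries.coeff d f else 0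
  have coeff_g (d : σ →₀ ℕ) : MvPowerSeries.coeff d g =
      if ↑d.support ⊆ s then MvPowerSeries.coeff d f else 0 := rfl
  refine ⟨g, fun i => MvPowerSeries.ext fun d => ?_, fun d hd => ?_⟩
  · rw [MvPowerSeries.coeff_pderiv, coeff_g, map_zero]
    split_ifs with hd
    · rw [← MvPowerSeries.coeff_pderiv, hf i (hd (by simp)), map_zero]
    · rw [zero_mul]
  · rw [map_sub, coeff_g, if_pos hd, sub_self]

theorem isCompleteFiltration_vanishingIdeal {s : ℕ → Set σ} (hs : Monotone s) :
    IsCompleteFiltration fun i => vanishingIdeal A (s i) := by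
  intro f hf
  have coeff_eq (d : σ →₀ ℕ) (i j : ℕ) (hij : i ≤ j) (hd : ↑d.support ⊆ s i) :
      MvPowerSeries.coeff d (f j) = MvPowerSeries.coeff d (f i) := by
    induction j, hij using Nat.le_induction with
    | base => rfl
    | succ j hij ih => rw [← ih, ← sub_eq_zero, ← map_sub, hf j d (hd.trans (hs hij))]
  have coeff_limit (d : σ →₀ ℕ) :
      ∃ c, ∀ i, ↑d.support ⊆ s i → c - MvPowerSeries.coeff d (f i) = 0 := by
    by_cases hd : ∃ i, ↑d.support ⊆ s i
    · obtain ⟨i₀, hi₀⟩ := hd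
      refine ⟨MvPowerSeries.coeff d (f i₀), fun i hi => sub_eq_zero.mpr ?_⟩
      obtain h | h := le_total i i₀
      · exact coeff_eq d i i₀ h hi
      · exact (coeff_eq d i₀ i h hi₀).symm
    · exact ⟨0, fun i hi => absurd ⟨i, hi⟩ hd⟩
  choose r hr using coeff_limit
  exact ⟨r, fun i d hd => hr d i hd⟩

theorem eq_zero_of_eventually_mem_vanishingIdeal {s : ℕ → Set σ}
    (hs : ∀ x, ∀ᶠ i in Filter.atTop, x ∈ s i) {f : MvPowerSeries σ A}
    (hf : ∀ᶠ i in Filter.atTop, f ∈ vanishingIdeal A (s i)) : f = 0 := by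
  ext d
  have hd : ∀ᶠ i in Filter.atTop, ∀ x ∈ d.support, x ∈ s i :=
    (Filter.eventually_all_finset d.support).mpr fun x _ => hs x
  obtain ⟨i, hfi, hdi⟩ := (hf.and hd).exists
  exact hfi d hdi

end Vanishing

/-- The ideal of the power series that vanish at `tᵢ₊₁ = tᵢ₊₂ = ⋯ = 0`. -/
def tailIdeal (A : Type*) [CommRing A] (i : ℕ) : Ideal (TimeSeries A) :=
  vanishingIdeal A {n : ℕ+ | (n : ℕ) ≤ i}

theorem isTimeFiltration_tailIdeal (A : Type*) [CommRing A] :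
    IsTimeFiltration (MvPowerSeries.pderiv A) (tailIdeal A) where
  complete := isCompleteFiltration_vanishingIdeal fun _ _ hij _ hn => le_trans hn hij
  separated _ hr := eq_zero_of_eventually_mem_vanishingIdeal
    (s := fun i => {n : ℕ+ | (n : ℕ) ≤ i}) (fun n => Filter.eventually_ge_atTop (n : ℕ)) hr
  deriv_mem _ i hn _ hr :=
    pderiv_mem_vanishingIdeal (s := {n : ℕ+ | (n : ℕ) ≤ i}) (Set.mem_ofPred.mpr hn) hr
  exists_sub_mem _ r hr := exists_sub_mem_vanishingIdeal _ r hr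

end TimeSeries

namespace ZMatrix

variable {A : Type*} [CommRing A]

theorem coe_sum_monomial (s : Finset ℕ) (a : ℕ → ℤ → TimeSeries A) :
    (∑ j ∈ s, DiffOp.monomial (a j) (j : ℤ)).1 = ∑ j ∈ s, diagShift (a j) (j : ℤ) :=
  AddSubmonoidClass.coe_finsetSum _ _

theorem eq_lowerSeries {L : DiffOp (TimeSeries A)} {k : ℤ} (hL : L ∈ DiffOp.ordLE ⊥ k) :
    L.1 = lowerSeries k fun l => DiffOp.coeff l L := by
  ext1 μ ν
  simp only [lowerSeries, Matrix.of_apply, DiffOp.coeff_apply, add_sub_cancel]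
  split_ifs with h
  · rfl
  · exact hL μ ν (by omega)

end ZMatrix

theorem mainTheorem4_general {A : Type*} [CommRing A]
    (b : ℕ+ → ℕ → ℤ → TimeSeries A) (B : ℕ+ → ZMatrix A)
    (hb : ∀ (n : ℕ+) (s : ℤ), b n n s = 1)
    (hB : ∀ n : ℕ+,
      B n = ∑ j ∈ Finset.range ((n : ℕ) + 1), ZMatrix.diagShift (b n j) (j : ℤ))
    (hZS : ∀ m n : ℕ+,
      ZMatrix.timeDeriv n (B m) - ZMatrix.timeDeriv m (B n) + ZMatrix.comm (B m) (B n) = 0) :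
    ∃ (u : ℤ → ℤ → TimeSeries A) (L : ZMatrix A),
      (∀ s : ℤ, u 1 s = 1) ∧ L = ZMatrix.lowerSeries 1 u ∧
        ∀ n : ℕ+, ZMatrix.timeDeriv n L - ZMatrix.comm (B n) L = 0 := by
  let C (n : ℕ+) : DiffOp (TimeSeries A) :=
    ∑ j ∈ Finset.range ((n : ℕ) + 1), DiffOp.monomial (b n j) j
  obtain rfl : B = fun n => (C n).1 :=
    funext fun n => (hB n).trans (ZMatrix.coe_sum_monomial _ _).symm
  have hC : DiffOp.IsZakharovShabat (MvPowerSeries.pderiv A) C :=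
    { isMonic := fun n => DiffOp.isMonic_sum_monomial (funext (hb n))
      curvature_eq_zero := fun m n => Subtype.ext (hZS m n) }
  obtain ⟨L, hL, hLax⟩ :=
    hC.exists_isMonic_laxDeriv_eq_zero (TimeSeries.isTimeFiltration_tailIdeal A) 1
  exact ⟨fun k => DiffOp.coeff k L, L.1, fun s => congrFun hL.coeff_eq_one s,
    ZMatrix.eq_lowerSeries hL.mem_ordLE, fun n => congrArg Subtype.val (hLax n)⟩

theorem mainTheorem4 {A : Type*} [CommRing A] [Algebra ℂ A]
    (b : ℕ+ → ℕ → ℤ → TimeSeries A) (B : ℕ+ → ZMatrix A)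
    (hb : ∀ (n : ℕ+) (s : ℤ), b n n s = 1)
    (hB : ∀ n : ℕ+,
      B n = ∑ j ∈ Finset.range ((n : ℕ) + 1), ZMatrix.diagShift (b n j) (j : ℤ))
    (hZS : ∀ m n : ℕ+,
      ZMatrix.timeDeriv n (B m) - ZMatrix.timeDeriv m (B n) + ZMatrix.comm (B m) (B n) = 0) :
    ∃ (u : ℤ → ℤ → TimeSeries A) (L : ZMatrix A),
      (∀ s : ℤ, u 1 s = 1) ∧ L = ZMatrix.lowerSeries 1 u ∧
        ∀ n : ℕ+, ZMatrix.timeDeriv n L - ZMatrix.comm (B n) L = 0 :=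
  mainTheorem4_general b B hb hB hZS
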